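/- **Definitions.** The *Petersen fragment* $F_0$ is obtained from the Petersen graph as follows: remove a vertex $x$ with neighbours $y,z,t$, keeping at $y,z,t$ loose half-edges $a_3,a_4,a_5$, respectively; subdivide each of the two remaining edges incident with $y$ by a new vertex; and attach a loose half-edge $a_1$ to one of the two new vertices and a loose half-edge $a_2$ to the other. (Up to isomorphism, $F_0$ does not depend on the choices made.) A *cubic Halin graph* is a finite simple cubic plane graph which is the union of a tree $T_0$ without vertices of degree $2$ and a circuit (connected $2$-regular graph) $C_0$ whose vertex set is the set of leaves of $T_0$. Given such a graph and a fixed direction of $C_0$, the *treelike snark* $G(T_0,C_0)$ is the cubic graph obtained from $T_0$ as follows. Each leaf $\ell$ of $T_0$ is replaced by a copy $F_0^\ell$ of the Petersen fragment with loose half-edges $a_1^\ell,\dots,a_5^\ell$, so that the edge of $T_0$ incident with $\ell$ becomes an edge containing the half-edge $a_3^\ell$ (joining the neighbour of $\ell$ in $T_0$ to the end of $a_3^\ell$). For each leaf $\ell$ and its successor $\ell'$ on $C_0$, the half-edge $a_4^\ell$ is joined to $a_2^{\ell'}$ and $a_5^\ell$ is joined to $a_1^{\ell'}$, forming new edges.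 The edges of $C_0$ themselves are not edges of $G(T_0,C_0)$. A *cycle* in a graph $G$ is a subgraph in which every vertex has even degree. A *5-cycle double cover* of $G$ is a family of five cycles in $G$ (possibly without edges, and possibly equal) such that every edge of $G$ belongs to exactly two members of the family. **Theorem 7.5.** Every treelike snark admits a 5-cycle double cover. -/

import Mathlib

namespace TreelikeSnarks

universe u

/-- The degree of a vertex (all graphs below are finite). -/
noncomputable def deg {V : Type*} (G : SimpleGraph V) (v : V) : ℕ :=
  (G.neighborSet v).ncard

/-- `G` is `k`-regular. -/
def IsRegular {V : Type*} (G : SimpleGraph V) (k : ℕ) : Prop :=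
  ∀ v, deg G v = k

/-! ### Cycle double covers -/

/-- A cycle in `G` is a subgraph in which every vertex has even degree. -/
def IsEvenSubgraph {V : Type*} {G : SimpleGraph V} (H : G.Subgraph) : Prop :=
  ∀ v ∈ H.verts, Even (H.neighborSet v).ncard

/-- `G` has a `k`-cycle double cover: a family of `k` cycles (some of them possibly without edges,
or equal) such that every edge of `G` belongs to exactly two members of the family. -/
def HasCycleDoubleCover {V : Type*} (G : SimpleGraph V) (k : ℕ) : Prop :=
  ∃ F : Fin k → G.Subgraph, (∀ i, IsEvenSubgraph (F i)) ∧
    ∀ e ∈ G.edgeSet, {i : Fin k | e ∈ (F i).edgeSet}.ncard = 2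

/-! ### Plane graphs -/

/-- A drawing of a graph in the plane without crossings: the vertices are distinct points, each
edge is a simple arc between its ends, an arc contains no vertices other than its ends, and arcs of
distinct edges meet only in vertices. -/
structure PlaneDrawing {V : Type*} (G : SimpleGraph V) where
  point : V → EuclideanSpace ℝ (Fin 2)
  point_injective : Function.Injective point
  arc : ∀ {u v : V}, G.Adj u v → Path (point u) (point v)
  arc_symm : ∀ {u v : V} (h : G.Adj u v), arc h.symm = (arc h).symm
  arc_injective : ∀ {u v : V} (h : G.Adj u v), Function.Injective (arc h)
  vertex_of_mem_arc : ∀ {u v w : V} (h : G.Adj u v) (t : unitInterval),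
    arc h t = point w → w = u ∨ w = v
  arc_inter : ∀ {u v u' v' : V} (h : G.Adj u v) (h' : G.Adj u' v') (t t' : unitInterval),
    s(u, v) ≠ s(u', v') → arc h t = arc h' t' → ∃ w, arc h t = point w

/-! ### Cubic Halin graphs -/

/-- A leaf is a vertex of degree one. -/
def IsLeaf {V : Type*} (T : SimpleGraph V) (v : V) : Prop := deg T v = 1

/-- The type of leaves of `T`. -/
abbrev Leaf {V : Type*} (T : SimpleGraph V) : Type _ := {v : V // IsLeaf T v}

/-- A circuit is a connected `2`-regular graph. -/
def IsCircuit {V : Type*} (C : SimpleGraph V) : Prop := C.Connected ∧ IsRegular C 2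

/-- The union of a tree `T` and a graph `C` on the set of its leaves. -/
def halinUnion {V : Type*} (T : SimpleGraph V) (C : SimpleGraph (Leaf T)) : SimpleGraph V :=
  T ⊔ C.map (Function.Embedding.subtype _)

/-- A cubic Halin graph: a cubic plane graph which is the union of a tree without vertices of
degree two and a circuit whose vertex set is the set of leaves of the tree. -/
structure CubicHalinGraph (V : Type u) where
  tree : SimpleGraph V
  isTree : tree.IsTree
  deg_ne_two : ∀ v, deg tree v ≠ 2
  circuit : SimpleGraph (Leaf tree)
  isCircuit : IsCircuit circuit
  cubic : IsRegular (halinUnion tree circuit) 3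
  planar : Nonempty (PlaneDrawing (halinUnion tree circuit))

/-- The permutation `succ` maps each vertex of the circuit `C` to its successor with respect to one
of the two directions of `C`: the two neighbours of `x` are `succ x` and its predecessor. -/
def IsDirection {L : Type*} (C : SimpleGraph L) (succ : Equiv.Perm L) : Prop :=
  ∀ x, C.Adj x (succ x) ∧ succ (succ x) ≠ x

/-! ### The Petersen fragment -/

/-- The Petersen graph: an outer pentagon `0 1 2 3 4`, an inner pentagram on `5 6 7 8 9`, and the
five edges `i (i + 5)`. -/
def petersen : SimpleGraph (Fin 10) :=
  SimpleGraph.fromEdgeSet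
    {s(0, 1), s(1, 2), s(2, 3), s(3, 4), s(4, 0),
     s(5, 7), s(7, 9), s(9, 6), s(6, 8), s(8, 5),
     s(0, 5), s(1, 6), s(2, 7), s(3, 8), s(4, 9)}

/-- The vertices of the Petersen fragment: those of the Petersen graph without the vertex `x = 0`,
and two further vertices subdividing the edges incident with `y = 1` that remain, namely
`sub 0` on the edge `1 2` and `sub 1` on the edge `1 6`. -/
inductive FragmentVertex : Type
  | old (v : Fin 10) (hv : v ≠ 0)
  | sub (j : Fin 2)

open FragmentVertex

/-- The edges of the Petersen fragment, each listed in at least one direction: the edges of the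
Petersen graph without `x = 0`, apart from the subdivided ones, and the halves of these. -/
inductive FragmentEdge : FragmentVertex → FragmentVertex → Prop
  | keep (u v : Fin 10) (hu : u ≠ 0) (hv : v ≠ 0) : petersen.Adj u v →
      s(u, v) ≠ s(1, 2) → s(u, v) ≠ s(1, 6) → FragmentEdge (old u hu) (old v hv)
  | half_one_two : FragmentEdge (old 1 (by decide)) (sub 0)
  | half_two_one : FragmentEdge (sub 0) (old 2 (by decide))
  | half_one_six : FragmentEdge (old 1 (by decide)) (sub 1)
  | half_six_one : FragmentEdge (sub 1) (old 6 (by decide))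

/-- The Petersen fragment without its loose half-edges. -/
def petersenFragment : SimpleGraph FragmentVertex :=
  SimpleGraph.fromRel FragmentEdge

/-- The vertex incident with the loose half-edge `a₁`. -/
def end₁ : FragmentVertex := sub 0

/-- The vertex incident with the loose half-edge `a₂`. -/
def end₂ : FragmentVertex := sub 1

/-- The vertex incident with the loose half-edge `a₃` (the neighbour `y` of `x`). -/
def end₃ : FragmentVertex := old 1 (by decide)

/-- The vertex incident with the loose half-edge `a₄` (the neighbour `z` of `x`). -/
def end₄ : FragmentVertex := old 4 (by decide)

/-- The vertex incident with the loose half-edge `a₅` (the neighbour `t` of `x`). -/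
def end₅ : FragmentVertex := old 5 (by decide)

/-! ### Treelike snarks -/

/-- The vertices of a treelike snark: the vertices of the tree that are not leaves, and for each
leaf the vertices of a copy of the Petersen fragment. -/
abbrev SnarkVertex {V : Type*} (T : SimpleGraph V) : Type _ :=
  {v : V // ¬ IsLeaf T v} ⊕ (Leaf T × FragmentVertex)

/-- The edges of a treelike snark, each listed in at least one direction. The edge of the tree
that ends in a leaf `l` becomes the edge that contains the half-edge `a₃` of the copy of the
fragment at `l` (two leaves of the tree of a cubic Halin graph are never adjacent in the tree). -/
inductive SnarkEdge {V : Type*} (T : SimpleGraph V) (succ : Equiv.Perm (Leaf T)) :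
    SnarkVertex T → SnarkVertex T → Prop
  | tree (u v : {v : V // ¬ IsLeaf T v}) : T.Adj u v → SnarkEdge T succ (.inl u) (.inl v)
  | central (u : {v : V // ¬ IsLeaf T v}) (l : Leaf T) : T.Adj u l →
      SnarkEdge T succ (.inl u) (.inr (l, end₃))
  | fragment (l : Leaf T) (p q : FragmentVertex) : petersenFragment.Adj p q →
      SnarkEdge T succ (.inr (l, p)) (.inr (l, q))
  | four_two (l : Leaf T) : SnarkEdge T succ (.inr (l, end₄)) (.inr (succ l, end₂))
  | five_one (l : Leaf T) : SnarkEdge T succ (.inr (l, end₅)) (.inr (succ l, end₁))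

/-- The treelike snark of a cubic Halin graph `H`, where `succ` is the successor map of the chosen
direction of the circuit of `H`. -/
def treelikeSnark {V : Type*} (H : CubicHalinGraph V) (succ : Equiv.Perm (Leaf H.tree)) :
    SimpleGraph (SnarkVertex H.tree) :=
  SimpleGraph.fromRel (SnarkEdge H.tree succ)

end TreelikeSnarks

namespace TreelikeSnarks

open FragmentVertex

/-! ### Edge colourings of forests -/

/-! It suffices to label the edges by two-element subsets of {0,…,4} with empty symmetric difference
at every vertex; the i-th cycle then consists of the edges whose label contains i
(`hasCycleDoubleCover_of_labelling`).

The tree has maximum degree 3, so its edges are properly coloured by the three nonzero elements of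
the Klein group (`exists_edge_coloring_of_isAcyclic`), read as the pairs inside {0,1,2}; three
distinct ones cancel at each inner vertex. Each leaf gets a potential s in the Klein group, which
fixes the labels of the two edges entering its fragment; their symmetric difference is the label of
s, empty for s = 0. If the central half-edge has colour c, the outgoing edges can carry the labels
of potential s + c: a finite table extends these boundary labels into the fragment for all s and all
c ≠ 0 (`isEnd₁` to `isEnd₅`, `isInner_of_ne_end`).

Such potentials close up around the circuit because the leaf colours sum to zero: summing colours
over all vertex-edge incidences counts every edge twice, and inner vertices contribute nothing
(`exists_colouring_and_potential`). -/

/-- The end of a longest path has all its neighbours on the path, and acyclicity leaves only the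
penultimate vertex. -/
theorem exists_unique_neighbor_of_isAcyclic {V : Type*} [Finite V] {T : SimpleGraph V}
    (hT : T.IsAcyclic) {a b : V} (hab : T.Adj a b) :
    ∃ u v, T.Adj u v ∧ ∀ w, T.Adj w v → w = u := by
  have : Nonempty V := ⟨a⟩
  obtain ⟨x, y, p, hp, hmax⟩ := SimpleGraph.Walk.exists_isPath_forall_isPath_length_le_length T
  have hpos : 1 ≤ p.length :=
    hmax a b hab.toWalk (by simp [SimpleGraph.Walk.isPath_def, hab.ne])
  have hnil : ¬ p.Nil := by
    rw [← SimpleGraph.Walk.length_eq_zero_iff]; omega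
  refine ⟨p.penultimate, y, p.adj_penultimate hnil, fun w hw => ?_⟩
  by_cases hws : w ∈ p.support
  · exact hT.eq_penultimate_of_adj_end hp hw.symm hws
  · have := hmax x w (p.concat hw.symm) (hp.concat hws hw.symm)
    simp at this

/-- A forest has a proper edge colouring with as many colours as its maximum degree. -/
theorem exists_edge_coloring_of_isAcyclic {V α : Type*} [Finite V] [Finite α] [Nonempty α]
    (T : SimpleGraph V) (hT : T.IsAcyclic)
    (hdeg : ∀ v, deg T v ≤ Nat.card α) :
    ∃ col : Sym2 V → α, ∀ v a b, T.Adj v a → T.Adj v b → a ≠ b →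
      col s(v, a) ≠ col s(v, b) := by
  classical
  induction hn : T.edgeSet.ncard using Nat.strong_induction_on generalizing T with
  | _ n ih =>
  by_cases hE : ∃ a b, T.Adj a b
  swap
  · push Not at hE
    exact ⟨fun _ => Classical.arbitrary α, fun v a b h => absurd h (hE _ _)⟩
  obtain ⟨a, b, hab⟩ := hE
  -- Induction on the number of edges: remove the pendant edge `uv`, colour the rest, and give `uv`
  -- a colour free at `u`.
  obtain ⟨u, v, huv, hv⟩ := exists_unique_neighbor_of_isAcyclic hT hab
  set T' := T.deleteEdges {s(u, v)} with hT'
  have hle : T' ≤ T := T.deleteEdges_le _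
  have hadj : ∀ x y, T'.Adj x y ↔ T.Adj x y ∧ s(x, y) ≠ s(u, v) := by
    intro x y; simp [hT', SimpleGraph.deleteEdges_adj]
  obtain ⟨col, hcol⟩ := ih T'.edgeSet.ncard
    (hn ▸ Set.ncard_lt_ncard (by
      refine ⟨SimpleGraph.edgeSet_mono hle, fun h => ?_⟩
      have : s(u, v) ∈ T'.edgeSet := h (T.mem_edgeSet.2 huv)
      simp [hadj] at this) (Set.toFinite _)) T' (hT.anti hle)
    (fun x => (Set.ncard_le_ncard (fun y hy => hle hy) (Set.toFinite _)).trans (hdeg x)) rfl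
  have hlt : ((fun w => col s(u, w)) '' T'.neighborSet u).ncard < Nat.card α := by
    refine (Set.ncard_image_le (Set.toFinite _)).trans_lt (lt_of_lt_of_le ?_ (hdeg u))
    refine Set.ncard_lt_ncard ⟨fun y hy => hle hy, fun h => ?_⟩ (Set.toFinite _)
    have : T'.Adj u v := h huv
    simp [hadj] at this
  obtain ⟨c, hc⟩ : ∃ c, c ∉ (fun w => col s(u, w)) '' T'.neighborSet u := by
    by_contra! h
    rw [Set.eq_univ_of_forall h, Set.ncard_univ] at hlt
    exact lt_irrefl _ hlt
  have hfree : ∀ x y z, s(x, y) = s(u, v) → T.Adj x z → z ≠ y → col s(x, z) ≠ c := by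
    intro x y z hxy hxz hzy hcz
    rcases Sym2.eq_iff.1 hxy with ⟨rfl, rfl⟩ | ⟨rfl, rfl⟩
    · refine hc ⟨z, (hadj _ _).2 ⟨hxz, fun h => ?_⟩, hcz⟩
      rcases Sym2.eq_iff.1 h with ⟨-, h⟩ | ⟨h, h'⟩
      · exact hzy h
      · exact huv.ne h
    · exact hzy (hv z hxz.symm)
  refine ⟨Function.update col s(u, v) c, fun x y z hy hz hyz => ?_⟩
  by_cases h1 : s(x, y) = s(u, v)
  · have h2 : s(x, z) ≠ s(u, v) := fun h => hyz (Sym2.congr_right.1 (h1.trans h.symm))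
    rw [h1, Function.update_self, Function.update_of_ne h2]
    exact (hfree x y z h1 hz hyz.symm).symm
  · by_cases h2 : s(x, z) = s(u, v)
    · rw [h2, Function.update_self, Function.update_of_ne h1]
      exact hfree x z y h2 hy hyz
    · rw [Function.update_of_ne h1, Function.update_of_ne h2]
      exact hcol x y z ((hadj _ _).2 ⟨hy, h1⟩) ((hadj _ _).2 ⟨hz, h2⟩) hyz

/-! ### Potentials along a cyclic permutation -/

theorem exists_potential_of_sum_eq_zero {L A : Type*} [Fintype L] [AddCommGroup A]
    (f : Equiv.Perm L) (hf : f.IsCycleOn Set.univ) (c : L → A) (hc : ∑ l, c l = 0) :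
    ∃ s : L → A, ∀ l, s (f l) = s l + c l := by
  classical
  rcases isEmpty_or_nonempty L with hL | ⟨⟨o⟩⟩
  · exact ⟨fun _ => 0, fun l => isEmptyElim l⟩
  have hf' : f.IsCycleOn ((Finset.univ : Finset L) : Set L) := by simpa using hf
  have hk : ∀ l, ∃ k < Fintype.card L, (f ^ k) o = l := fun l =>
    hf'.exists_pow_eq (Finset.mem_univ o) (Finset.mem_univ l)
  choose k hk hko using hk
  -- Number the elements along the cycle from `o` and take partial sums of `c`; only the return to
  -- `o` needs the total to vanish.
  let S : ℕ → A := fun n => ∑ j ∈ Finset.range n, c ((f ^ j) o)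
  have htotal : S (Fintype.card L) = 0 := by
    rw [← hc]
    refine Finset.sum_bij (fun j _ => (f ^ j) o) (fun _ _ => Finset.mem_univ _) ?_ ?_
      (fun _ _ => rfl)
    · intro i hi j hj hij
      have := (hf'.pow_apply_eq_pow_apply (Finset.mem_univ o)).1 hij
      rw [Finset.card_univ] at this
      exact this.eq_of_lt_of_lt (Finset.mem_range.1 hi) (Finset.mem_range.1 hj)
    · intro l _
      exact ⟨k l, Finset.mem_range.2 (hk l), hko l⟩
  have hstep : ∀ n, S (n + 1) = S n + c ((f ^ n) o) := fun n => Finset.sum_range_succ _ n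
  refine ⟨fun l => S (k l), fun l => ?_⟩
  have hmod : k (f l) ≡ k l + 1 [MOD Fintype.card L] := by
    rw [← Finset.card_univ]
    refine (hf'.pow_apply_eq_pow_apply (Finset.mem_univ o)).1 ?_
    rw [hko, pow_succ', Equiv.Perm.mul_apply, hko]
  change S (k (f l)) = S (k l) + c l
  have hs := hstep (k l)
  rw [hko] at hs
  rw [← hs]
  rcases (Nat.succ_le_of_lt (hk l)).lt_or_eq with h | h
  · rw [hmod.eq_of_lt_of_lt (hk _) h]
  · have h0 : k (f l) ≡ 0 [MOD Fintype.card L] := by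
      refine hmod.trans ?_
      rw [← Nat.succ_eq_add_one, h]
      simp [Nat.ModEq]
    rw [← Nat.succ_eq_add_one, h, htotal,
      h0.eq_of_lt_of_lt (hk _) (Fintype.card_pos_iff.2 ⟨o⟩)]
    simp [S]

/-! ### Directions of circuits -/

theorem IsDirection.eq_or_eq_of_adj {L : Type*} {C : SimpleGraph L} (hC : IsRegular C 2)
    {succ : Equiv.Perm L} (h : IsDirection C succ) {x y : L} (hxy : C.Adj x y) :
    y = succ x ∨ x = succ y := by
  have hpred : C.Adj x (succ.symm x) := by simpa using (h (succ.symm x)).1.symm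
  have hne : succ x ≠ succ.symm x := fun e => (h (succ.symm x)).2 (by simp [e])
  -- `ncard` is 0 on infinite sets, so the value 2 forces finiteness.
  have hfin : (C.neighborSet x).Finite := Set.finite_of_ncard_ne_zero (by
    have := hC x
    unfold deg at this
    omega)
  have hset : ({succ x, succ.symm x} : Set L) = C.neighborSet x := by
    refine Set.eq_of_subset_of_ncard_le ?_ ?_ hfin
    · rintro z (rfl | rfl)
      exacts [(h x).1, hpred]
    · rw [Set.ncard_pair hne]
      exact (hC x).le
  have : y ∈ ({succ x, succ.symm x} : Set L) := hset ▸ hxy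
  rcases this with h | h
  · exact .inl h
  · right
    rw [h]; simp

theorem IsDirection.isCycleOn {L : Type*} {C : SimpleGraph L} (hC : IsCircuit C)
    {succ : Equiv.Perm L} (h : IsDirection C succ) : succ.IsCycleOn Set.univ := by
  suffices hs : ∀ x y, succ.SameCycle x y from
    ⟨Set.bijOn_univ.2 succ.bijective, fun x _ y _ => hs x y⟩
  intro x y
  obtain ⟨p⟩ := hC.1.preconnected x y
  induction p with
  | nil => exact .refl _ _
  | cons hadj _ ih =>
    refine Equiv.Perm.SameCycle.trans ?_ ih
    rcases h.eq_or_eq_of_adj hC.2 hadj with rfl | rfl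
    · exact ⟨1, by simp⟩
    · exact ⟨-1, by simp⟩

/-! ### Cycle double covers from labellings -/

/-- The labels of edges, as bit masks, are the two-element subsets of `Fin 5`. -/
def pairLabels : List ℕ := [3, 5, 6, 9, 10, 12, 17, 18, 20, 24]

theorem ncard_testBit_of_mem_pairLabels {x : ℕ} (hx : x ∈ pairLabels) :
    {i : Fin 5 | x.testBit i = true}.ncard = 2 := by
  rw [← Finset.coe_filter_univ, Set.ncard_coe_finset]
  revert x
  decide

/-- Bit `i` of the sum is the parity of the number of labels that contain `i`. -/
theorem even_ncard_of_xor_eq_zero {W : Type*} (f : W → ℕ) {a b c : W} (hab : a ≠ b) (hac : a ≠ c)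
    (hbc : b ≠ c) (h : f a ^^^ f b ^^^ f c = 0) (i : ℕ) :
    Even {w | w ∈ ({a, b, c} : Set W) ∧ (f w).testBit i = true}.ncard := by
  classical
  have hset : {w | w ∈ ({a, b, c} : Set W) ∧ (f w).testBit i = true} =
      ((({a, b, c} : Finset W).filter fun w => (f w).testBit i = true : Finset W) : Set W) := by
    ext; simp
  have hx := congrArg (fun n => n.testBit i) h
  simp only [Nat.testBit_xor, Nat.zero_testBit] at hx
  rw [hset, Set.ncard_coe_finset, Finset.card_filter, Finset.sum_insert (by simp [hab, hac]),
    Finset.sum_insert (by simp [hbc]), Finset.sum_singleton]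
  revert hx
  cases (f a).testBit i <;> cases (f b).testBit i <;> cases (f c).testBit i <;> decide

/-- A cubic graph has a `5`-cycle double cover if its edges can be labelled by two-element subsets
of `Fin 5` so that the symmetric difference of the labels at each vertex is empty. -/
theorem hasCycleDoubleCover_of_labelling {W : Type*} {G : SimpleGraph W} (f : W → W → ℕ)
    (hsymm : ∀ v w, f v w = f w v) (hpair : ∀ v w, G.Adj v w → f v w ∈ pairLabels)
    (hvertex : ∀ v, ∃ a b c, a ≠ b ∧ a ≠ c ∧ b ≠ c ∧ G.neighborSet v = {a, b, c} ∧
      f v a ^^^ f v b ^^^ f v c = 0) :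
    HasCycleDoubleCover G 5 := by
  refine ⟨fun i =>
    { verts := Set.univ
      Adj := fun v w => G.Adj v w ∧ (f v w).testBit i = true
      adj_sub := fun h => h.1
      edge_vert := fun _ => Set.mem_univ _
      symm := ⟨fun v w h => ⟨h.1.symm, hsymm v w ▸ h.2⟩⟩ }, fun i v _ => ?_, fun e => ?_⟩
  · obtain ⟨a, b, c, hab, hac, hbc, hN, hx⟩ := hvertex v
    have := even_ncard_of_xor_eq_zero (f v) hab hac hbc hx i
    rw [← hN] at this
    exact this
  · induction e using Sym2.ind with
    | _ v w =>
    intro h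
    have hvw : G.Adj v w := h
    simpa [hvw] using ncard_testBit_of_mem_pairLabels (hpair v w hvw)

/-! ### Labellings of the Petersen fragment -/

/-- A number for each vertex of the Petersen fragment. -/
def FragmentVertex.code : FragmentVertex → ℕ
  | old v _ => v
  | sub j => 10 + j

theorem FragmentVertex.code_injective : Function.Injective code := by
  rintro (⟨u, hu⟩ | i) (⟨v, hv⟩ | j) h <;> simp only [code] at h
  · simpa [Fin.ext_iff] using h
  · omega
  · omega
  · congr 1
    omega

instance : DecidableEq FragmentVertex := fun _ _ =>
  decidable_of_iff _ code_injective.eq_iff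

theorem FragmentVertex.forall_iff {P : FragmentVertex → Prop} :
    (∀ p, P p) ↔ (∀ v hv, P (old v hv)) ∧ ∀ j, P (sub j) :=
  ⟨fun h => ⟨fun v hv => h _, fun j => h _⟩, fun h p => by
    cases p with
    | old v hv => exact h.1 v hv
    | sub j => exact h.2 j⟩

instance (P : FragmentVertex → Prop) [DecidablePred P] : Decidable (∀ p, P p) :=
  decidable_of_iff _ forall_iff.symm

instance : DecidableRel petersen.Adj := fun u v =>
  decidable_of_iff
    (s(u, v) ∈ ({s(0, 1), s(1, 2), s(2, 3), s(3, 4), s(4, 0),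
     s(5, 7), s(7, 9), s(9, 6), s(6, 8), s(8, 5),
     s(0, 5), s(1, 6), s(2, 7), s(3, 8), s(4, 9)} : Finset (Sym2 (Fin 10))) ∧ u ≠ v)
    (by simp [petersen])

/-- The edges of the Petersen fragment, as pairs of codes of vertices in increasing order. -/
def fragmentEdges : List (ℕ × ℕ) :=
  [(2, 3), (3, 4), (5, 7), (7, 9), (6, 9), (6, 8), (5, 8), (2, 7), (3, 8), (4, 9),
    (1, 10), (2, 10), (1, 11), (6, 11)]

/-- Turns adjacency into membership in an explicit list, so that the checks on the fragment become
decidable. -/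
theorem petersenFragment_adj_iff (p q : FragmentVertex) : petersenFragment.Adj p q ↔
    (min p.code q.code, max p.code q.code) ∈ fragmentEdges := by
  have hkeep : ∀ u v : Fin 10, u ≠ 0 → v ≠ 0 → petersen.Adj u v → s(u, v) ≠ s(1, 2) →
      s(u, v) ≠ s(1, 6) → (min (u : ℕ) v, max (u : ℕ) v) ∈ fragmentEdges := by
    decide +kernel
  have hedge : ∀ p q, FragmentEdge p q →
      (min p.code q.code, max p.code q.code) ∈ fragmentEdges := by
    intro p q h
    cases h with
    | keep u v hu hv h h₁ h₂ => exact hkeep u v hu hv h h₁ h₂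
    | _ => decide
  have hold : ∀ u v : Fin 10, (min (u : ℕ) v, max (u : ℕ) v) ∈ fragmentEdges →
      u ≠ v ∧ petersen.Adj u v ∧ s(u, v) ≠ s(1, 2) ∧ s(u, v) ≠ s(1, 6) := by
    decide +kernel
  have hsub : ∀ (v : Fin 10) (j : Fin 2), (min (v : ℕ) (10 + j), max (v : ℕ) (10 + j)) ∈
      fragmentEdges → (v = 1 ∨ v = 2) ∧ j = 0 ∨ (v = 1 ∨ v = 6) ∧ j = 1 := by
    decide +kernel
  have hsub' : ∀ i j : Fin 2, (min (10 + i : ℕ) (10 + j), max (10 + i : ℕ) (10 + j)) ∉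
      fragmentEdges := by
    decide +kernel
  have hhalf : ∀ (v : Fin 10) (hv : v ≠ 0) (j : Fin 2),
      (min (v : ℕ) (10 + j), max (v : ℕ) (10 + j)) ∈ fragmentEdges →
      petersenFragment.Adj (old v hv) (sub j) := by
    intro v hv j h
    refine (SimpleGraph.fromRel_adj _ _ _).2 ⟨by simp, ?_⟩
    rcases hsub v j h with ⟨rfl | rfl, rfl⟩ | ⟨rfl | rfl, rfl⟩
    exacts [.inl .half_one_two, .inr .half_two_one, .inl .half_one_six, .inr .half_six_one]
  constructor
  · intro h
    rcases ((SimpleGraph.fromRel_adj _ _ _).1 h).2 with h | h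
    · exact hedge _ _ h
    · rw [min_comm, max_comm]
      exact hedge _ _ h
  · intro h
    cases p with
    | old u hu =>
      cases q with
      | old v hv =>
        obtain ⟨h₁, h₂, h₃, h₄⟩ := hold u v h
        exact (SimpleGraph.fromRel_adj _ _ _).2 ⟨by simpa using h₁, .inl (.keep u v hu hv h₂ h₃ h₄)⟩
      | sub j => exact hhalf u hu j h
    | sub i =>
      cases q with
      | old v hv =>
        rw [min_comm, max_comm] at h
        exact (hhalf v hv i h).symm
      | sub j => exact absurd h (hsub' i j)

instance : DecidableRel petersenFragment.Adj := fun p q =>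
  decidable_of_iff _ (petersenFragment_adj_iff p q).symm

/-- The Klein four-group, whose nonzero elements are the colours of the edges of the tree. -/
abbrev Klein : Type := ZMod 2 × ZMod 2

/-- The label of an edge of the tree of a given colour. -/
def colourLabel (c : Klein) : ℕ :=
  if c = (1, 0) then 3 else if c = (0, 1) then 5 else if c = (1, 1) then 6 else 0

/-- The labels of the half-edges `a₂` and `a₁` of the fragment at a leaf of given potential. -/
def linkLabels (s : Klein) : ℕ × ℕ :=
  -- The two entries always add up to `colourLabel s`; 24 is the pair {3,4}, disjoint from all
  -- colour labels.
  if s = (1, 0) then (5, 6) else if s = (0, 1) then (6, 3) else if s = (1, 1) then (3, 5)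
  else (24, 24)

/-- Labels of the edges of the fragment at a leaf of potential `s` with the central half-edge
coloured `c`, in the order of `fragmentEdges`. -/
def fragmentLabels (s c : Klein) : List ℕ :=
  if s = (1, 0) then
    if c = (1, 0) then [5, 9, 18, 20, 5, 6, 10, 6, 12, 17, 5, 3, 6, 3]
    else if c = (0, 1) then [9, 17, 20, 24, 10, 9, 17, 12, 24, 18, 3, 5, 6, 3]
    -- The last branch for `c` is meant for (1,1); the value 0 also falls here but is excluded
    -- wherever the table is used.
    else [9, 10, 18, 24, 20, 18, 17, 10, 3, 12, 5, 3, 3, 6]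
  else if s = (0, 1) then
    if c = (1, 0) then [3, 17, 3, 10, 24, 20, 6, 9, 18, 18, 9, 10, 10, 12]
    else if c = (0, 1) then [3, 9, 17, 24, 9, 3, 9, 9, 10, 17, 9, 10, 12, 10]
    else [10, 9, 20, 24, 20, 17, 18, 12, 3, 12, 5, 6, 3, 5]
  else if s = (1, 1) then
    if c = (1, 0) then [5, 20, 17, 24, 10, 3, 18, 9, 17, 18, 9, 12, 10, 9]
    else if c = (0, 1) then [10, 9, 20, 24, 20, 17, 18, 12, 3, 12, 3, 6, 6, 5]
    else [3, 9, 17, 20, 5, 3, 9, 5, 10, 17, 3, 6, 5, 6]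
  else
    if c = (1, 0) then [3, 9, 10, 24, 20, 6, 12, 18, 10, 12, 9, 17, 10, 18]
    else if c = (0, 1) then [3, 10, 6, 20, 24, 12, 5, 18, 9, 12, 9, 17, 12, 20]
    else [3, 9, 3, 18, 24, 12, 6, 17, 10, 10, 10, 18, 12, 20]

/-- The label of an edge of the fragment at a leaf of potential `s` with the central half-edge
coloured `c`. -/
def fragmentLabel (s c : Klein) (p q : FragmentVertex) : ℕ :=
  ((fragmentEdges.zip (fragmentLabels s c)).lookup
    (min p.code q.code, max p.code q.code)).getD 0

theorem fragmentLabel_comm (s c : Klein) (p q : FragmentVertex) :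
    fragmentLabel s c p q = fragmentLabel s c q p := by
  simp only [fragmentLabel, min_comm, max_comm]

theorem fragmentLabel_mem_pairLabels (s : Klein) {c : Klein} (hc : c ≠ 0) {p q : FragmentVertex}
    (h : petersenFragment.Adj p q) : fragmentLabel s c p q ∈ pairLabels := by
  have key : ∀ s c : Klein, c ≠ 0 → ∀ e ∈ fragmentEdges,
      ((fragmentEdges.zip (fragmentLabels s c)).lookup e).getD 0 ∈ pairLabels := by
    decide +kernel
  exact key s c hc _ ((petersenFragment_adj_iff p q).1 h)

theorem colourLabel_mem_pairLabels {c : Klein} (hc : c ≠ 0) : colourLabel c ∈ pairLabels := by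
  revert c
  decide

theorem linkLabels_mem_pairLabels (s : Klein) :
    (linkLabels s).1 ∈ pairLabels ∧ (linkLabels s).2 ∈ pairLabels := by
  revert s
  decide

/-- `p` has two neighbours in the Petersen fragment, and the labels of the edges that join them to
`p` add up to `t s c`. -/
def IsEnd (p : FragmentVertex) (t : Klein → Klein → ℕ) : Prop :=
  ∃ a b, a ≠ b ∧ (∀ q, petersenFragment.Adj p q ↔ q = a ∨ q = b) ∧
    ∀ s c : Klein, c ≠ 0 → fragmentLabel s c p a ^^^ fragmentLabel s c p b ^^^ t s c = 0

theorem isEnd₁ : IsEnd end₁ fun s _ => (linkLabels s).2 :=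
  ⟨old 1 (by decide), old 2 (by decide), by decide +kernel, by decide +kernel, by decide +kernel⟩

theorem isEnd₂ : IsEnd end₂ fun s _ => (linkLabels s).1 :=
  ⟨old 1 (by decide), old 6 (by decide), by decide +kernel, by decide +kernel, by decide +kernel⟩

theorem isEnd₃ : IsEnd end₃ fun _ c => colourLabel c :=
  ⟨sub 0, sub 1, by decide +kernel, by decide +kernel, by decide +kernel⟩

/-- This half-edge leads to the next leaf, whose potential is `s + c`. -/
theorem isEnd₄ : IsEnd end₄ fun s c => (linkLabels (s + c)).1 :=
  ⟨old 3 (by decide), old 9 (by decide), by decide +kernel, by decide +kernel, by decide +kernel⟩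

theorem isEnd₅ : IsEnd end₅ fun s c => (linkLabels (s + c)).2 :=
  ⟨old 7 (by decide), old 8 (by decide), by decide +kernel, by decide +kernel, by decide +kernel⟩

/-- `p` has three neighbours in the Petersen fragment, and the labels of the edges that join them
to `p` add up to zero. -/
def IsInner (p : FragmentVertex) : Prop :=
  ∃ a b d, a ≠ b ∧ a ≠ d ∧ b ≠ d ∧
    (∀ q, petersenFragment.Adj p q ↔ q = a ∨ q = b ∨ q = d) ∧
    ∀ s c : Klein, c ≠ 0 →
      fragmentLabel s c p a ^^^ fragmentLabel s c p b ^^^ fragmentLabel s c p d = 0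

theorem isInner_of_ne_end (p : FragmentVertex) (h₁ : p ≠ end₁) (h₂ : p ≠ end₂)
    (h₃ : p ≠ end₃) (h₄ : p ≠ end₄) (h₅ : p ≠ end₅) : IsInner p := by
  cases p with
  | old v hv =>
    fin_cases v
    · exact absurd rfl hv
    · exact absurd rfl h₃
    · exact (⟨old 3 (by decide), old 7 (by decide), sub 0, by decide +kernel⟩ :
        IsInner (old 2 (by decide)))
    · exact (⟨old 2 (by decide), old 4 (by decide), old 8 (by decide), by decide +kernel⟩ :
        IsInner (old 3 (by decide)))
    · exact absurd rfl h₄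
    · exact absurd rfl h₅
    · exact (⟨old 8 (by decide), old 9 (by decide), sub 1, by decide +kernel⟩ :
        IsInner (old 6 (by decide)))
    · exact (⟨old 2 (by decide), old 5 (by decide), old 9 (by decide), by decide +kernel⟩ :
        IsInner (old 7 (by decide)))
    · exact (⟨old 3 (by decide), old 5 (by decide), old 6 (by decide), by decide +kernel⟩ :
        IsInner (old 8 (by decide)))
    · exact (⟨old 4 (by decide), old 6 (by decide), old 7 (by decide), by decide +kernel⟩ :
        IsInner (old 9 (by decide)))
  | sub j =>
    fin_cases j
    · exact absurd rfl h₁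
    · exact absurd rfl h₂

variable {V : Type*}

/-! ### Colours and potentials at the leaves -/

namespace CubicHalinGraph

variable (H : CubicHalinGraph V)

/-- Circuit edges join leaves only, so all three edges at an inner vertex belong to the tree. -/
theorem deg_tree_of_not_isLeaf {v : V} (hv : ¬ IsLeaf H.tree v) : deg H.tree v = 3 := by
  rw [← H.cubic v]
  unfold deg
  congr 1
  ext w
  simp only [SimpleGraph.mem_neighborSet, halinUnion, SimpleGraph.sup_adj, SimpleGraph.map_adj]
  refine ⟨.inl, ?_⟩
  rintro (h | ⟨x, y, -, rfl, -⟩)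
  · exact h
  · exact absurd x.2 hv

theorem deg_tree_le_three (v : V) : deg H.tree v ≤ 3 := by
  by_cases hv : IsLeaf H.tree v
  · exact hv.le.trans (by norm_num)
  · exact (H.deg_tree_of_not_isLeaf hv).le

/-- By connectedness, two adjacent leaves would be the whole tree, whereas a direction of the
circuit yields three distinct leaves `l`, `succ l`, `succ (succ l)`. -/
theorem not_isLeaf_of_adj_leaf {succ : Equiv.Perm (Leaf H.tree)}
    (hsucc : IsDirection H.circuit succ) {l : Leaf H.tree} {v : V} (h : H.tree.Adj l v) :
    ¬ IsLeaf H.tree v := by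
  intro hv
  have huniq : ∀ {x y z : V}, IsLeaf H.tree x → H.tree.Adj x y → H.tree.Adj x z → z = y := by
    intro x y z hx hy hz
    obtain ⟨a, ha⟩ := Set.ncard_eq_one.1 hx
    have h₁ : y ∈ H.tree.neighborSet x := hy
    have h₂ : z ∈ H.tree.neighborSet x := hz
    rw [ha] at h₁ h₂
    exact Eq.trans h₂ (Eq.symm h₁)
  have hwalk : ∀ x y : V, H.tree.Walk x y → (x = l ∨ x = v) → (y = l ∨ y = v) := by
    intro x y p
    induction p with
    | nil => exact id
    | cons hadj _ ih =>
      rintro (rfl | rfl)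
      · exact ih (.inr (huniq l.2 h hadj))
      · exact ih (.inl (huniq hv h.symm hadj))
  have hall : ∀ m : Leaf H.tree, m = l ∨ m = ⟨v, hv⟩ := by
    intro m
    obtain ⟨p⟩ := H.isTree.connected.preconnected (l : V) m
    simpa [Subtype.ext_iff] using hwalk _ _ p (.inl rfl)
  have h₁ := (hall (succ l)).resolve_left (hsucc l).1.ne'
  have h₂ := (hall (succ (succ l))).resolve_left (hsucc l).2
  exact (hsucc (succ l)).1.ne (h₁.trans h₂.symm)

/-- The edges of the tree can be coloured by nonzero elements of the Klein four-group, and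
potentials be assigned to the leaves, so that the three colours at a vertex that is not a leaf add
up to zero, and the potential increases along the circuit by the colours at the leaves. -/
theorem exists_colouring_and_potential [Finite V] {succ : Equiv.Perm (Leaf H.tree)}
    (hsucc : IsDirection H.circuit succ) :
    ∃ (col : Sym2 V → Klein) (s : Leaf H.tree → Klein) (nb : Leaf H.tree → V),
      (∀ e, col e ≠ 0) ∧ (∀ v, ¬ IsLeaf H.tree v → ∃ a b c, a ≠ b ∧ a ≠ c ∧ b ≠ c ∧
        H.tree.neighborSet v = {a, b, c} ∧
        colourLabel (col s(v, a)) ^^^ colourLabel (col s(v, b)) ^^^ colourLabel (col s(v, c)) = 0) ∧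
      (∀ (l : Leaf H.tree) (w : V), H.tree.Adj w l ↔ w = nb l) ∧
      ∀ l : Leaf H.tree, s (succ l) = s l + col s(nb l, l) := by
  have hthree : ∀ x y z : Klein, x ≠ 0 → y ≠ 0 → z ≠ 0 → x ≠ y → x ≠ z → y ≠ z →
      x + (y + z) = 0 ∧ colourLabel x ^^^ colourLabel y ^^^ colourLabel z = 0 := by
    decide
  classical
  have := Fintype.ofFinite V
  have : Nonempty {c : Klein // c ≠ 0} := ⟨(1, 0), by decide⟩
  obtain ⟨col, hcol⟩ := exists_edge_coloring_of_isAcyclic (α := {c : Klein // c ≠ 0}) H.tree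
    H.isTree.isAcyclic (fun v => (H.deg_tree_le_three v).trans (by
      rw [Nat.card_eq_fintype_card]; decide))
  have hnb : ∀ l : Leaf H.tree, ∃ u, ∀ w, H.tree.Adj w l ↔ w = u := by
    intro l
    obtain ⟨u, hu⟩ := Set.ncard_eq_one.1 l.2
    refine ⟨u, fun w => ?_⟩
    rw [H.tree.adj_comm, ← SimpleGraph.mem_neighborSet, hu, Set.mem_singleton_iff]
  choose nb hnb using hnb
  have hinner : ∀ v, ¬ IsLeaf H.tree v → ∃ a b c, a ≠ b ∧ a ≠ c ∧ b ≠ c ∧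
      H.tree.neighborSet v = {a, b, c} ∧
      (col s(v, a) + (col s(v, b) + col s(v, c)) : Klein) = 0 ∧
      colourLabel (col s(v, a)) ^^^ colourLabel (col s(v, b)) ^^^ colourLabel (col s(v, c)) = 0 := by
    intro v hv
    obtain ⟨a, b, c, hab, hac, hbc, hN⟩ := Set.ncard_eq_three.1 (H.deg_tree_of_not_isLeaf hv)
    have hmem : ∀ w, H.tree.Adj v w ↔ w = a ∨ w = b ∨ w = c := by
      intro w
      rw [← SimpleGraph.mem_neighborSet, hN]
      simp
    refine ⟨a, b, c, hab, hac, hbc, hN, hthree _ _ _ (col _).2 (col _).2 (col _).2 ?_ ?_ ?_⟩ <;>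
      exact Subtype.coe_ne_coe.2 <| hcol v _ _ ((hmem _).2 (by simp)) ((hmem _).2 (by simp)) (by assumption)
  let g : V → V → Klein := fun v w => if H.tree.Adj v w then col s(v, w) else 0
  -- Reversing an incidence pairs equal terms, which cancel in characteristic 2.
  have hdouble : ∑ v, ∑ w, g v w = 0 := by
    rw [← Fintype.sum_prod_type']
    refine Finset.sum_involution (fun p _ => p.swap) ?_ ?_ (fun _ _ => Finset.mem_univ _)
      (fun _ _ => Prod.swap_swap _)
    · rintro ⟨v, w⟩ -
      simp only [g, Prod.swap, H.tree.adj_comm w v, Sym2.eq_swap (a := w)]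
      exact CharTwo.add_self_eq_zero _
    · rintro ⟨v, w⟩ - hne heq
      have : w = v := congrArg Prod.fst heq
      subst this
      simp [g] at hne
  have hsum : ∑ l : Leaf H.tree, (col s(nb l, l) : Klein) = 0 := by
    refine Eq.trans ?_ hdouble
    rw [← Fintype.sum_subtype_add_sum_subtype (IsLeaf H.tree) fun v => ∑ w, g v w]
    have hzero : ∑ v : {v // ¬ IsLeaf H.tree v}, ∑ w, g v w = 0 := by
      refine Finset.sum_eq_zero fun v _ => ?_
      obtain ⟨a, b, c, hab, hac, hbc, hN, hs, -⟩ := hinner v v.2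
      have hmem : ∀ w, H.tree.Adj v w ↔ w ∈ ({a, b, c} : Finset V) := by
        intro w
        rw [← SimpleGraph.mem_neighborSet, hN]
        simp
      simp only [g, hmem]
      rw [Finset.sum_ite_mem, Finset.univ_inter, Finset.sum_insert (by simp [hab, hac]),
        Finset.sum_insert (by simp [hbc]), Finset.sum_singleton, hs]
    rw [hzero, add_zero]
    refine Finset.sum_congr rfl fun l _ => ?_
    simp only [g, H.tree.adj_comm (l : V), hnb]
    simp [Sym2.eq_swap]
  obtain ⟨s, hs⟩ := exists_potential_of_sum_eq_zero succ (hsucc.isCycleOn H.isCircuit)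
    (fun l => (col s(nb l, l) : Klein)) hsum
  refine ⟨fun e => col e, s, nb, fun e => (col e).2, fun v hv => ?_, hnb, hs⟩
  obtain ⟨a, b, c, hab, hac, hbc, hN, -, hx⟩ := hinner v hv
  exact ⟨a, b, c, hab, hac, hbc, hN, hx⟩

end CubicHalinGraph

/-! ### Adjacency in treelike snarks -/

/-- The end `p` of a half-edge at a fragment is joined to the end `q` at the next fragment. -/
def IsLink (p q : FragmentVertex) : Prop := p = end₄ ∧ q = end₂ ∨ p = end₅ ∧ q = end₁

section Adjacency

variable {H : CubicHalinGraph V} {succ : Equiv.Perm (Leaf H.tree)}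

theorem treelikeSnark_adj_inl_inl (u v : {v : V // ¬ IsLeaf H.tree v}) :
    (treelikeSnark H succ).Adj (.inl u) (.inl v) ↔ H.tree.Adj u v := by
  refine (SimpleGraph.fromRel_adj _ _ _).trans ⟨?_, fun h => ⟨?_, .inl (.tree u v h)⟩⟩
  · rintro ⟨-, h | h⟩
    · cases h with | tree _ _ h => exact h
    · cases h with | tree _ _ h => exact h.symm
  · rintro ⟨⟩
    exact h.ne rfl

theorem treelikeSnark_adj_inl_inr (u : {v : V // ¬ IsLeaf H.tree v}) (l : Leaf H.tree)
    (p : FragmentVertex) :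
    (treelikeSnark H succ).Adj (.inl u) (.inr (l, p)) ↔ H.tree.Adj u l ∧ p = end₃ := by
  refine (SimpleGraph.fromRel_adj _ _ _).trans ⟨?_, ?_⟩
  · rintro ⟨-, h | h⟩
    · cases h with | central _ _ h => exact ⟨h, rfl⟩
    · cases h
  · rintro ⟨h, rfl⟩
    exact ⟨by simp, .inl (.central u l h)⟩

theorem treelikeSnark_adj_inr_inr (hsucc : ∀ l, succ l ≠ l) (l m : Leaf H.tree)
    (p q : FragmentVertex) :
    (treelikeSnark H succ).Adj (.inr (l, p)) (.inr (m, q)) ↔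
      m = l ∧ petersenFragment.Adj p q ∨ m = succ l ∧ IsLink p q ∨ l = succ m ∧ IsLink q p := by
  refine (SimpleGraph.fromRel_adj _ _ _).trans ⟨?_, ?_⟩
  · rintro ⟨-, h | h⟩
    · cases h with
      | fragment _ _ _ h => exact .inl ⟨rfl, h⟩
      | four_two => exact .inr (.inl ⟨rfl, .inl ⟨rfl, rfl⟩⟩)
      | five_one => exact .inr (.inl ⟨rfl, .inr ⟨rfl, rfl⟩⟩)
    · cases h with
      | fragment _ _ _ h => exact .inl ⟨rfl, h.symm⟩
      | four_two => exact .inr (.inr ⟨rfl, .inl ⟨rfl, rfl⟩⟩)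
      | five_one => exact .inr (.inr ⟨rfl, .inr ⟨rfl, rfl⟩⟩)
  · rintro (⟨rfl, h⟩ | ⟨rfl, ⟨rfl, rfl⟩ | ⟨rfl, rfl⟩⟩ | ⟨rfl, ⟨rfl, rfl⟩ | ⟨rfl, rfl⟩⟩)
    · exact ⟨by simpa using h.ne, .inl (.fragment _ _ _ h)⟩
    · exact ⟨by simp [(hsucc l).symm], .inl (.four_two l)⟩
    · exact ⟨by simp [(hsucc l).symm], .inl (.five_one l)⟩
    · exact ⟨by simp [hsucc m], .inr (.four_two m)⟩
    · exact ⟨by simp [hsucc m], .inr (.five_one m)⟩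

end Adjacency

/-! ### The labelling -/

/-- The label of the edge between a fragment and the next one, which has potential `s`, if the edge
leaves the former at `p`. -/
def linkLabel (s : Klein) (p : FragmentVertex) : ℕ :=
  if p = end₄ then (linkLabels s).1 else (linkLabels s).2

open Classical in
/-- The labelling of the edges of a treelike snark given by a colouring of the tree and potentials
at its leaves. -/
noncomputable def snarkLabel {T : SimpleGraph V} (succ : Equiv.Perm (Leaf T))
    (col : Sym2 V → Klein) (s : Leaf T → Klein) (nb : Leaf T → V) :
    SnarkVertex T → SnarkVertex T → ℕ
  | .inl u, .inl v => colourLabel (col s(u, v))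
  | .inl u, .inr (l, _) => colourLabel (col s(u, l))
  | .inr (l, _), .inl u => colourLabel (col s(u, l))
  | .inr (l, p), .inr (m, q) =>
    if m = l then fragmentLabel (s l) (col s(nb l, l)) p q
    else if m = succ l then linkLabel (s m) p
    else if l = succ m then linkLabel (s l) q
    else 0

/-- Exchanging the arguments swaps the two link tests, which cannot both succeed because `succ` has
no orbit of length 2. -/
theorem snarkLabel_comm {T : SimpleGraph V} {succ : Equiv.Perm (Leaf T)}
    (hsucc : ∀ l, succ (succ l) ≠ l) (col : Sym2 V → Klein) (s : Leaf T → Klein)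
    (nb : Leaf T → V) (v w : SnarkVertex T) :
    snarkLabel succ col s nb v w = snarkLabel succ col s nb w v := by
  rcases v with u | ⟨l, p⟩ <;> rcases w with v | ⟨m, q⟩
  · simp only [snarkLabel, Sym2.eq_swap]
  · rfl
  · rfl
  · simp only [snarkLabel]
    by_cases h : m = l
    · subst h
      simp [fragmentLabel_comm]
    · rw [if_neg h, if_neg (Ne.symm h)]
      by_cases h₁ : m = succ l
      · subst h₁
        rw [if_pos rfl, if_neg (hsucc l).symm, if_pos rfl]
      · simp only [if_neg h₁]

/-- Treats all five half-edges at once: `φ` embeds a copy of the fragment, and `d` is the vertex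
across the half-edge. -/
theorem exists_neighbors_of_isEnd {W : Type*} {G : SimpleGraph W} {f : W → W → ℕ}
    {φ : FragmentVertex → W} (hφ : Function.Injective φ) {p : FragmentVertex}
    {t : Klein → Klein → ℕ} (hp : IsEnd p t) {s c : Klein} (hc : c ≠ 0)
    (hf : ∀ q, f (φ p) (φ q) = fragmentLabel s c p q) {d : W} (hd : ∀ q, d ≠ φ q)
    (hN : ∀ w, G.Adj (φ p) w ↔ (∃ q, petersenFragment.Adj p q ∧ φ q = w) ∨ w = d)
    (ht : f (φ p) d = t s c) :
    ∃ a b c, a ≠ b ∧ a ≠ c ∧ b ≠ c ∧ G.neighborSet (φ p) = {a, b, c} ∧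
      f (φ p) a ^^^ f (φ p) b ^^^ f (φ p) c = 0 := by
  obtain ⟨a, b, hab, hadj, hx⟩ := hp
  refine ⟨φ a, φ b, d, hφ.ne hab, (hd a).symm, (hd b).symm, ?_, ?_⟩
  · ext w
    simp only [SimpleGraph.mem_neighborSet, hN, hadj, Set.mem_insert_iff, Set.mem_singleton_iff]
    grind
  · rw [hf, hf, ht, hx s c hc]

end TreelikeSnarks

open TreelikeSnarks in
theorem theorem7p5 {V : Type*} [Finite V] (H : TreelikeSnarks.CubicHalinGraph V)
    (succ : Equiv.Perm (TreelikeSnarks.Leaf H.tree))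
    (hsucc : TreelikeSnarks.IsDirection H.circuit succ) :
    TreelikeSnarks.HasCycleDoubleCover (TreelikeSnarks.treelikeSnark H succ) 5 := by
  obtain ⟨col, s, nb, hcol, hinner, hnb, hs⟩ := H.exists_colouring_and_potential hsucc
  have hne : ∀ l, succ l ≠ l := fun l => (hsucc l).1.ne'
  have hne₂ : ∀ l, succ (succ l) ≠ l := fun l => (hsucc l).2
  have hsurj : ∀ l, ∃ m, l = succ m := fun l => ⟨succ.symm l, by simp⟩
  refine hasCycleDoubleCover_of_labelling (snarkLabel succ col s nb)
    (snarkLabel_comm hne₂ col s nb) ?_ ?_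
  · rintro (u | ⟨l, p⟩) (v | ⟨m, q⟩) h
    · exact colourLabel_mem_pairLabels (hcol _)
    · exact colourLabel_mem_pairLabels (hcol _)
    · exact colourLabel_mem_pairLabels (hcol _)
    · have hlink : ∀ s p, linkLabel s p ∈ pairLabels := by
        intro s p
        unfold linkLabel
        split_ifs
        exacts [(linkLabels_mem_pairLabels s).1, (linkLabels_mem_pairLabels s).2]
      rw [treelikeSnark_adj_inr_inr hne] at h
      simp only [snarkLabel]
      rcases h with ⟨rfl, h⟩ | ⟨rfl, h⟩ | ⟨rfl, h⟩
      · rw [if_pos rfl]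
        exact fragmentLabel_mem_pairLabels _ (hcol _) h
      · rw [if_neg (hne l), if_pos rfl]
        exact hlink _ _
      · rw [if_neg (hne m).symm, if_neg (hne₂ m).symm, if_pos rfl]
        exact hlink _ _
  · rintro (⟨u, hu⟩ | ⟨l, p⟩)
    · obtain ⟨a, b, c, hab, hac, hbc, hN, hx⟩ := hinner u hu
      have hmem : ∀ w, H.tree.Adj u w ↔ w = a ∨ w = b ∨ w = c := by
        intro w
        rw [← SimpleGraph.mem_neighborSet, hN]
        simp
      classical
      -- A leaf stands for the end of `a₃` in its fragment; this carries the tree neighbours of `u`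
      -- to its snark neighbours.
      let φ : V → SnarkVertex H.tree := fun w =>
        if hw : IsLeaf H.tree w then .inr (⟨w, hw⟩, end₃) else .inl ⟨w, hw⟩
      have hφ : Function.Injective φ := by
        intro x y h
        simp only [φ] at h
        split_ifs at h <;> simp_all
      have hf : ∀ w, snarkLabel succ col s nb (.inl ⟨u, hu⟩) (φ w) = colourLabel (col s(u, w)) := by
        intro w
        simp only [φ]
        split_ifs <;> rfl
      refine ⟨φ a, φ b, φ c, hφ.ne hab, hφ.ne hac, hφ.ne hbc, ?_, by rw [hf, hf, hf, hx]⟩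
      have himage : (treelikeSnark H succ).neighborSet (.inl ⟨u, hu⟩) =
          φ '' H.tree.neighborSet u := by
        ext w
        rw [SimpleGraph.mem_neighborSet, Set.mem_image]
        rcases w with ⟨v, hv⟩ | ⟨m, q⟩
        · rw [treelikeSnark_adj_inl_inl]
          refine ⟨fun h => ⟨v, h, dif_neg hv⟩, ?_⟩
          rintro ⟨x, hx, h⟩
          simp only [φ] at h
          split_ifs at h
          obtain rfl : x = v := by simpa using h
          exact hx
        · rw [treelikeSnark_adj_inl_inr]
          constructor
          · rintro ⟨h, rfl⟩
            exact ⟨m, h, dif_pos m.2⟩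
          · rintro ⟨x, hx, h⟩
            simp only [φ] at h
            split_ifs at h
            obtain ⟨rfl, rfl⟩ := Prod.ext_iff.1 (Sum.inr_injective h)
            exact ⟨hx, rfl⟩
      rw [himage, hN, Set.image_insert_eq, Set.image_pair]
    · have hnl : ¬ IsLeaf H.tree (nb l) :=
        H.not_isLeaf_of_adj_leaf hsucc ((hnb l _).2 rfl).symm
      -- Naming the predecessor `k` makes the fragments on both sides explicit.
      obtain ⟨k, rfl⟩ := hsurj l
      set l := succ k with hl
      let φ : FragmentVertex → SnarkVertex H.tree := fun q => .inr (l, q)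
      have hφ : Function.Injective φ := fun x y h => by simpa [φ] using h
      have hadj : ∀ w, (treelikeSnark H succ).Adj (φ p) w ↔
          (∃ q, petersenFragment.Adj p q ∧ φ q = w) ∨
          (p = end₃ ∧ w = .inl ⟨nb l, hnl⟩) ∨
          (p = end₄ ∧ w = .inr (succ l, end₂)) ∨ (p = end₅ ∧ w = .inr (succ l, end₁)) ∨
          (p = end₂ ∧ w = .inr (k, end₄)) ∨ (p = end₁ ∧ w = .inr (k, end₅)) := by
        rintro (⟨v, hv⟩ | ⟨m, q⟩)
        · rw [SimpleGraph.adj_comm, treelikeSnark_adj_inl_inr, hnb]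
          simp [φ, and_comm]
        · have hk : l = succ m ↔ m = k := by rw [hl, succ.injective.eq_iff, eq_comm]
          rw [treelikeSnark_adj_inr_inr hne, hk]
          simp only [φ, IsLink, Sum.inr.injEq, Prod.mk.injEq, reduceCtorEq]
          grind
      have hf : ∀ q, snarkLabel succ col s nb (φ p) (φ q) =
          fragmentLabel (s l) (col s(nb l, l)) p q := fun q => if_pos rfl
      -- The recursion for the potentials yields the `s + c` required by `isEnd₄` and `isEnd₅`.
      have hout : ∀ q, snarkLabel succ col s nb (φ p) (.inr (succ l, q)) =
          linkLabel (s l + col s(nb l, l)) p := by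
        intro q
        simp only [φ, snarkLabel]
        rw [if_neg (hne l), if_pos trivial, hs]
      have hin : ∀ q, snarkLabel succ col s nb (φ p) (.inr (k, q)) = linkLabel (s l) q := by
        intro q
        simp only [φ, snarkLabel]
        rw [if_neg (hne k).symm, if_neg (hne₂ k).symm, if_pos hl]
      have hdist : end₁ ≠ end₂ ∧ end₁ ≠ end₃ ∧ end₁ ≠ end₄ ∧ end₁ ≠ end₅ ∧ end₂ ≠ end₃ ∧
        end₂ ≠ end₄ ∧ end₂ ≠ end₅ ∧ end₃ ≠ end₄ ∧ end₃ ≠ end₅ ∧ end₄ ≠ end₅ := by decide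
      by_cases h₁ : p = end₁
      · subst h₁
        exact exists_neighbors_of_isEnd hφ isEnd₁ (hcol s(nb l, l)) hf (d := .inr (k, end₅))
          (by simp [φ, l, (hne k).symm]) (by simpa [hdist] using hadj)
          ((hin _).trans (if_neg hdist.2.2.2.2.2.2.2.2.2.symm))
      by_cases h₂ : p = end₂
      · subst h₂
        exact exists_neighbors_of_isEnd hφ isEnd₂ (hcol s(nb l, l)) hf (d := .inr (k, end₄))
          (by simp [φ, l, (hne k).symm]) (by simpa [hdist, hdist.1.symm] using hadj)
          ((hin _).trans (if_pos rfl))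
      by_cases h₃ : p = end₃
      · subst h₃
        exact exists_neighbors_of_isEnd hφ isEnd₃ (hcol s(nb l, l)) hf (d := .inl ⟨nb l, hnl⟩)
          (by simp [φ]) (by simpa [hdist, Ne.symm h₁, Ne.symm h₂, h₁, h₂] using hadj) rfl
      by_cases h₄ : p = end₄
      · subst h₄
        exact exists_neighbors_of_isEnd hφ isEnd₄ (hcol s(nb l, l)) hf (d := .inr (succ l, end₂))
          (by simp [φ, hne l]) (by simpa [hdist, h₁, h₂, h₃] using hadj)
          ((hout _).trans (if_pos rfl))
      by_cases h₅ : p = end₅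
      · subst h₅
        exact exists_neighbors_of_isEnd hφ isEnd₅ (hcol s(nb l, l)) hf (d := .inr (succ l, end₁))
          (by simp [φ, hne l]) (by simpa [h₁, h₂, h₃, h₄] using hadj)
          ((hout _).trans (if_neg h₄))
      obtain ⟨a, b, d, hab, had, hbd, hN, hx⟩ := isInner_of_ne_end p h₁ h₂ h₃ h₄ h₅
      refine ⟨φ a, φ b, φ d, hφ.ne hab, hφ.ne had, hφ.ne hbd, ?_, ?_⟩
      · ext w
        refine (hadj w).trans ?_
        simp only [h₁, h₂, h₃, h₄, h₅, hN, Set.mem_insert_iff, Set.mem_singleton_iff]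
        grind
      · exact (congrArg₂ _ (congrArg₂ _ (hf a) (hf b)) (hf d)).trans (hx _ _ (hcol _))
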